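/- Let $s,Q\ge 1$ be integers, $N=sQ$, $P_x>0$, $\sigma_w>0$, and fix a delay $t_d\in\{0,\dots,Q-1\}$. Signal. Let $\mathbf x=(x_1,\dots,x_N)\sim\mathcal{CN}(0,K_{\mathbf x})$ be a complex proper zero-mean Gaussian vector that is low-pass circularly wide-sense stationary: $K_{\mathbf x}=\mathbb E[\mathbf x\mathbf x^\dagger]$ is circulant with $\operatorname{tr}K_{\mathbf x}=P_x$, and the $k$-th column ($k=0,\dots,N-1$) of the DFT matrix with entries $\frac1{\sqrt N}e^{-2\pi j tk/N}$, $0\le t,k\le N-1$, is an eigenvector of $K_{\mathbf x}$ with eigenvalue $P_x/s$ if $k\le s-1$ and with eigenvalue $0$ otherwise. Energy. Let $E_1,\dots,E_N$ be i.i.d. random variables with $0\le E_t\le E_{\max}$ almost surely, mean $\mu_E>0$ and variance $\varrho_E$, and write $E_{\max}=r_E\,\mu_E$. Let $\bar E_k=\sum_{t=1}^{Q}E_{(k-1)Q+t}$, $k=1,\dots,s$, be the energy collected in slot $k$. Transmission. At the end of slot $k$ one sample is sent, $y_k=\sqrt{p_k}\,x_{Q(k-1)+t_d+1}+w_k$,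 $k=1,\dots,s$, where $\mathbf w=(w_1,\dots,w_s)\sim\mathcal{CN}(0,\sigma_w^2I_s)$ is complex proper zero-mean Gaussian and independent of $\mathbf x$, and where $p_k\ge0$ uses all the stored energy: $\mathbb E_S\big[|\sqrt{p_k}\,x_{Q(k-1)+t_d+1}|^2\big]=\bar E_k$. Here $\mathbb E_S$ is the expectation over $(\mathbf x,\mathbf w)$ for a fixed realization of the energy arrivals. Let $$\varepsilon=\mathbb E_S\big[\|\mathbf x-\mathbb E_S[\mathbf x\mid\mathbf y]\|^2\big]$$ be the minimum mean-square error, which is a function of the energy arrivals. Bounds. With $h(a)=(1+a)\log(1+a)-a$ put $$f_{bt}(\mu,\varrho,r)=2s\exp\Big(-\frac{\varrho}{\mu^2}\,h\Big(\frac{\mu r}{\varrho}\Big)\Big),\qquad f_{bn}(\mu,\varrho,r)=2s\exp\Big(-\frac{r^2/2}{\mu r/3+\varrho}\Big),$$ where $f_{bt}(\mu,0,r)=0$, the limit as $\varrho\downarrow0$. Then for every $r\in(0,1)$, with probability taken over the energy arrivals, $$\mathbb P\Big(\varepsilon<\frac{P_x}{1+\frac1{\sigma_w^2}\,\mu_E\,\frac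 Ns\,(1-r)}\Big)\ \ge\ 1-f_{bt}(\mu_I^u,\varrho_I^u,r)\ \ge\ 1-f_{bn}(\mu_I^u,\varrho_I^u,r),$$ where $\mu_I^u=\max\{r_E-1,1\}$ and $\varrho_I^u=\dfrac{\varrho_E}{\mu_E^2}\,\dfrac sN$. -/

import Mathlib

open MeasureTheory ProbabilityTheory

noncomputable section

/-- `X ∼ CN(0, K)`: complex proper (circularly symmetric) zero-mean Gaussian random vector with
covariance matrix `E[X X†] = K`; properness is the vanishing of the pseudo-covariance `E[X Xᵀ]`.
The law may be degenerate. -/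
structure IsProperGaussian {Ω ι : Type*} [MeasurableSpace Ω] [Fintype ι]
    (X : Ω → EuclideanSpace ℂ ι) (K : Matrix ι ι ℂ) (P : Measure Ω) : Prop where
  measurable : Measurable X
  gaussian : HasGaussianLaw X P
  mean_zero : ∀ i, ∫ ω, X ω i ∂P = 0
  covariance : ∀ i j, ∫ ω, X ω i * star (X ω j) ∂P = K i j
  proper : ∀ i j, ∫ ω, X ω i * X ω j ∂P = 0

/-- The unitary discrete Fourier transform matrix of size `N`, with indices starting at `0`. -/
def dftMatrix (N : ℕ) : Matrix (Fin N) (Fin N) ℂ :=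
  Matrix.of fun t k =>
    (1 / (Real.sqrt N : ℂ)) *
      Complex.exp (-Complex.I * (2 * Real.pi / N) * ((t : ℕ) : ℂ) * ((k : ℕ) : ℂ))

/-- A covariance matrix is that of a circularly wide-sense stationary signal if it is circulant:
the entry in row `t` and column `k` depends only on `k - t` modulo `N`. -/
def IsCWSS {N : ℕ} (K : Matrix (Fin N) (Fin N) ℂ) : Prop :=
  ∃ K₁ : Fin N → ℂ, ∀ t k, K t k = K₁ (k - t)

/-- Low-pass c.w.s.s. covariance matrix with `s` degrees of freedom and total power `Px`: it is
circulant with trace `Px`, the low frequencies `0, …, s - 1` (columns of the DFT matrix) are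
eigenvectors for the eigenvalue `Px / s`, and all the other frequencies for the eigenvalue `0`. -/
structure IsLowPassCWSS {N : ℕ} (s : ℕ) (Px : ℝ) (K : Matrix (Fin N) (Fin N) ℂ) : Prop where
  cwss : IsCWSS K
  trace_eq : K.trace = (Px : ℂ)
  low_pass : ∀ k : Fin N, K.mulVec (fun t => dftMatrix N t k) =
    (if (k : ℕ) < s then ((Px / s : ℝ) : ℂ) else 0) • (fun t => dftMatrix N t k)

/-- Position (starting at `0`) of the `t`-th epoch of the `k`-th slot when `N = s * Q` epochs are
divided into `s` consecutive slots of length `Q`; its value is `Q * k + t`. -/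
def epoch {N s Q : ℕ} (hN : N = s * Q) (k : Fin s) (t : Fin Q) : Fin N :=
  Fin.cast hN.symm (finProdFinEquiv (k, t))

/-- Total energy that arrives during slot `k`. -/
def slotEnergy {N s Q : ℕ} (hN : N = s * Q) (e : Fin N → ℝ) (k : Fin s) : ℝ :=
  ∑ t : Fin Q, e (epoch hN k t)

/-- Average energy (over the signal) used in slot `k` for sending the sample with offset `td` with
amplification `√p`. -/
def usedEnergy {Ω : Type*} [MeasurableSpace Ω] (P : Measure Ω) {N s Q : ℕ} (hN : N = s * Q)
    (td : Fin Q) (x : Ω → EuclideanSpace ℂ (Fin N)) (k : Fin s) (p : ℝ) : ℝ :=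
  ∫ ω, ‖(Real.sqrt p : ℂ) * x ω (epoch hN k td)‖ ^ 2 ∂P

/-- Received signal of the equidistant single-sample scheme: in slot `k` it is
`√(p k) * x_{Q k + td} + w_k`. -/
def received {Ω : Type*} {N s Q : ℕ} (hN : N = s * Q) (td : Fin Q)
    (x : Ω → EuclideanSpace ℂ (Fin N)) (w : Ω → EuclideanSpace ℂ (Fin s)) (p : Fin s → ℝ) :
    Ω → EuclideanSpace ℂ (Fin s) :=
  fun ω => WithLp.toLp 2 fun k => (Real.sqrt (p k) : ℂ) * x ω (epoch hN k td) + w ω k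

/-- Minimum mean-square error `E ‖x - E[x | y]‖²` of estimating `x` from `y`. -/
def mmse {Ω : Type*} [MeasurableSpace Ω] (P : Measure Ω) {N m : ℕ}
    (x : Ω → EuclideanSpace ℂ (Fin N)) (y : Ω → EuclideanSpace ℂ (Fin m)) : ℝ :=
  ∫ ω, ‖x ω - (P[x | MeasurableSpace.comap y inferInstance]) ω‖ ^ 2 ∂P

/-- `h(a) = (1 + a) log (1 + a) - a`. -/
def bennettH (a : ℝ) : ℝ := (1 + a) * Real.log (1 + a) - a

/-- The Bennett-type tail `2 s exp(-(ϱ / μ²) h(μ r / ϱ))`. The formula divides by `ϱ`; at `ϱ = 0` the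
value is its limit `0` as `ϱ ↓ 0` (for `μ, r > 0`). -/
def fbt (s : ℕ) (μ ϱ r : ℝ) : ℝ :=
  if ϱ = 0 then 0 else 2 * s * Real.exp (-(ϱ / μ ^ 2) * bennettH (μ * r / ϱ))

/-- The Bernstein-type tail `2 s exp(-(r² / 2) / (μ r / 3 + ϱ))`. -/
def fbn (s : ℕ) (μ ϱ r : ℝ) : ℝ :=
  2 * s * Real.exp (-((r ^ 2 / 2) / (μ * r / 3 + ϱ)))

end

/-!
A low-pass covariance matrix `K` is a multiple of an orthogonal projection, and samples taken at the
Nyquist rate are uncorrelated. The linear estimator of `x` therefore decouples over the slots, and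
its error, which bounds the minimum mean-square error, is `∑ k, (Px / s) / (1 + u k / σw ^ 2)`,
where `u k` is the energy used in slot `k`. It is below the target as soon as every slot has
collected more than the fraction `1 - r` of its mean energy, and a union bound leaves the
probability that a given slot falls short. Bennett's inequality bounds it: the energies are
nonnegative, so in a slot of length `Q` the deficit of one epoch is at most the fraction `1 / Q` of
the mean energy of the slot.
-/

theorem exp_sub_one_sub_eq_integral (u : ℝ) :
    Real.exp u - 1 - u = u ^ 2 * ∫ t in (0 : ℝ)..1, (1 - t) * Real.exp (t * u) := by
  have hderiv : ∀ t ∈ Set.uIcc (0 : ℝ) 1,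
      HasDerivAt (fun t => (1 - t) * u * Real.exp (t * u) + Real.exp (t * u))
        (u ^ 2 * ((1 - t) * Real.exp (t * u))) t := by
    intro t _
    have hexp : HasDerivAt (fun t : ℝ => Real.exp (t * u)) (Real.exp (t * u) * (1 * u)) t :=
      ((hasDerivAt_id t).mul_const u).exp
    have hlin : HasDerivAt (fun t : ℝ => (1 - t) * u) (-1 * u) t :=
      ((hasDerivAt_id t).const_sub 1).mul_const u
    exact ((hlin.mul hexp).add hexp).congr_deriv (by ring)
  rw [← intervalIntegral.integral_const_mul,
    intervalIntegral.integral_eq_sub_of_hasDerivAt hderiv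
      (Continuous.intervalIntegrable (by fun_prop) _ _)]
  simp
  ring

/- `(exp u - 1 - u) / u ^ 2` is increasing in `u`; clearing the denominator `u ^ 2` keeps the case
`u = 0`. -/
theorem exp_sub_one_sub_le {u c : ℝ} (huc : u ≤ c) (hc : 0 < c) :
    Real.exp u - 1 - u ≤ u ^ 2 / c ^ 2 * (Real.exp c - 1 - c) := by
  rw [exp_sub_one_sub_eq_integral u, exp_sub_one_sub_eq_integral c, div_mul_eq_mul_div,
    mul_div_assoc, mul_div_cancel_left₀ _ (by positivity)]
  refine mul_le_mul_of_nonneg_left ?_ (sq_nonneg u)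
  refine intervalIntegral.integral_mono_on zero_le_one
    (Continuous.intervalIntegrable (by fun_prop) _ _)
    (Continuous.intervalIntegrable (by fun_prop) _ _) fun t ⟨ht0, ht1⟩ => ?_
  have := sub_nonneg.2 ht1
  gcongr

/-- The bound of Bennett's inequality on the probability that a sum of independent centered random
variables, bounded above by `b` and of total variance `V`, reaches `r`. The formula divides by `V`;
at `V = 0` the value is its limit `0`. -/
noncomputable def bennettTail (b V r : ℝ) : ℝ :=
  if V = 0 then 0 else Real.exp (-(V / b ^ 2) * bennettH (b * r / V))

theorem bennettTail_nonneg (b V r : ℝ) : 0 ≤ bennettTail b V r := by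
  unfold bennettTail
  split_ifs <;> positivity

theorem fbt_eq_two_mul_bennettTail (s : ℕ) (μ ϱ r : ℝ) :
    fbt s μ ϱ r = 2 * s * bennettTail μ ϱ r := by
  unfold fbt bennettTail
  split_ifs <;> simp

section Bennett

variable {Ω ι : Type*} [MeasurableSpace Ω] {P : Measure Ω} [IsProbabilityMeasure P]

theorem mgf_le_exp_variance_mul {X : Ω → ℝ} {b l : ℝ} (hX : MemLp X 2 P)
    (hXb : ∀ᵐ ω ∂P, X ω ≤ b) (hb : 0 < b) (hmean : ∫ ω, X ω ∂P = 0) (hl : 0 < l) :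
    mgf X P l ≤ Real.exp (variance X P * ((Real.exp (l * b) - 1 - l * b) / b ^ 2)) := by
  set C := (Real.exp (l * b) - 1 - l * b) / b ^ 2 with hC
  have hX1 : Integrable X P := hX.integrable one_le_two
  have hlin : Integrable (fun ω => 1 + l * X ω) P := (integrable_const 1).add (hX1.const_mul l)
  have hquad : Integrable (fun ω => C * X ω ^ 2) P := hX.integrable_sq.const_mul C
  calc mgf X P l ≤ ∫ ω, (1 + l * X ω + C * X ω ^ 2) ∂P := by
        refine integral_mono_ae (integrable_exp_mul_of_le l b hl.le hX.aemeasurable hXb)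
          (hlin.add hquad) ?_
        filter_upwards [hXb] with ω hω
        have h := exp_sub_one_sub_le (mul_le_mul_of_nonneg_left hω hl.le) (mul_pos hl hb)
        have hCX : (l * X ω) ^ 2 / (l * b) ^ 2 * (Real.exp (l * b) - 1 - l * b) = C * X ω ^ 2 := by
          rw [hC]
          field_simp
        linarith
    _ = variance X P * C + 1 := by
        rw [integral_add hlin hquad, integral_add (integrable_const 1) (hX1.const_mul l),
          integral_const_mul, integral_const_mul, hmean,
          variance_of_integral_eq_zero hX.aemeasurable hmean]
        simp
        ring
    _ ≤ Real.exp (variance X P * C) := Real.add_one_le_exp _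

variable [Fintype ι] {X : ι → Ω → ℝ} {b r : ℝ}

theorem measureReal_le_sum_le_exp (hind : iIndepFun X P) (hX : ∀ i, MemLp (X i) 2 P)
    (hXb : ∀ i, ∀ᵐ ω ∂P, X i ω ≤ b) (hb : 0 < b) (hmean : ∀ i, ∫ ω, X i ω ∂P = 0) {l : ℝ}
    (hl : 0 < l) :
    P.real {ω | r ≤ ∑ i, X i ω} ≤
      Real.exp (-l * r + (∑ i, variance (X i) P) * ((Real.exp (l * b) - 1 - l * b) / b ^ 2)) := by
  have hsum_le : ∀ᵐ ω ∂P, (∑ i, X i) ω ≤ ∑ _i : ι, b := by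
    filter_upwards [ae_all_iff.2 hXb] with ω hω
    rw [Finset.sum_apply]
    exact Finset.sum_le_sum fun i _ => hω i
  have hsum : AEMeasurable (∑ i, X i) P := Finset.aemeasurable_sum _ fun i _ => (hX i).aemeasurable
  calc P.real {ω | r ≤ ∑ i, X i ω} = P.real {ω | r ≤ (∑ i, X i) ω} := by
        simp only [Finset.sum_apply]
    _ ≤ Real.exp (-l * r) * mgf (∑ i, X i) P l :=
        measure_ge_le_exp_mul_mgf r hl.le (integrable_exp_mul_of_le l _ hl.le hsum hsum_le)
    _ = Real.exp (-l * r) * ∏ i, mgf (X i) P l := by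
        rw [hind.mgf_sum₀ fun i => (hX i).aemeasurable]
    _ ≤ Real.exp (-l * r) *
          ∏ i, Real.exp (variance (X i) P * ((Real.exp (l * b) - 1 - l * b) / b ^ 2)) := by
        gcongr with i
        · exact fun i _ => mgf_nonneg
        · exact mgf_le_exp_variance_mul (hX i) (hXb i) hb (hmean i) hl
    _ = _ := by rw [← Real.exp_sum, ← Finset.sum_mul, ← Real.exp_add]

theorem bennett_exponent_eq {V : ℝ} (hb : 0 < b) (hV : 0 < V) (hr : 0 < r) :
    -(Real.log (1 + b * r / V) / b) * r +
        V * ((Real.exp (Real.log (1 + b * r / V) / b * b) - 1 -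
          Real.log (1 + b * r / V) / b * b) / b ^ 2) =
      -(V / b ^ 2) * bennettH (b * r / V) := by
  rw [div_mul_cancel₀ _ hb.ne', Real.exp_log (by positivity), bennettH]
  field_simp
  ring

theorem measureReal_le_sum_eq_zero_of_variance_eq_zero (hX : ∀ i, MemLp (X i) 2 P)
    (hmean : ∀ i, ∫ ω, X i ω ∂P = 0) (hvar : ∀ i, variance (X i) P = 0) (hr : 0 < r) :
    P.real {ω | r ≤ ∑ i, X i ω} = 0 := by
  have hX0 : ∀ᵐ ω ∂P, ∀ i, X i ω = 0 := by
    refine ae_all_iff.2 fun i => ?_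
    filter_upwards [ae_eq_integral_of_variance_eq_zero (hX i) (hvar i)] with ω hω
    rw [hω, hmean]
  rw [measureReal_eq_zero_iff, measure_eq_zero_iff_ae_notMem]
  filter_upwards [hX0] with ω hω
  simp [hω, hr]

theorem measureReal_le_sum_le_bennettTail (hind : iIndepFun X P) (hX : ∀ i, MemLp (X i) 2 P)
    (hXb : ∀ i, ∀ᵐ ω ∂P, X i ω ≤ b) (hb : 0 < b) (hmean : ∀ i, ∫ ω, X i ω ∂P = 0) (hr : 0 < r) :
    P.real {ω | r ≤ ∑ i, X i ω} ≤ bennettTail b (∑ i, variance (X i) P) r := by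
  have hvar : ∀ i ∈ Finset.univ, 0 ≤ variance (X i) P := fun i _ => variance_nonneg _ _
  rcases (Finset.sum_nonneg hvar).eq_or_lt with hV | hV
  · rw [← hV, bennettTail, if_pos rfl]
    exact (measureReal_le_sum_eq_zero_of_variance_eq_zero hX hmean
      (fun i => (Finset.sum_eq_zero_iff_of_nonneg hvar).1 hV.symm i (Finset.mem_univ i)) hr).le
  · have hl : 0 < Real.log (1 + b * r / ∑ i, variance (X i) P) / b :=
      div_pos (Real.log_pos (lt_add_of_pos_right 1 (by positivity))) hb
    rw [bennettTail, if_neg hV.ne', ← bennett_exponent_eq hb hV hr]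
    exact measureReal_le_sum_le_exp hind hX hXb hb hmean hl

theorem measureReal_sum_le_le_bennettTail (hind : iIndepFun X P) (hX : ∀ i, MemLp (X i) 2 P)
    (hX0 : ∀ i, ∀ᵐ ω ∂P, 0 ≤ X i ω) {m : ℝ} (hm : ∑ i, ∫ ω, X i ω ∂P = m) (hm0 : 0 < m)
    (hb : ∀ i, ∫ ω, X i ω ∂P ≤ b * m) (hb0 : 0 < b) (hr : 0 < r) :
    P.real {ω | ∑ i, X i ω ≤ m * (1 - r)} ≤
      bennettTail b ((∑ i, variance (X i) P) / m ^ 2) r := by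
  set Y : ι → Ω → ℝ := fun i ω => m⁻¹ * (∫ ω', X i ω' ∂P - X i ω) with hY
  have hYind : iIndepFun Y P :=
    hind.comp (fun i e => m⁻¹ * (∫ ω', X i ω' ∂P - e)) fun _ => by fun_prop
  have hYL : ∀ i, MemLp (Y i) 2 P := fun i => ((memLp_const _).sub (hX i)).const_mul _
  have hYb : ∀ i, ∀ᵐ ω ∂P, Y i ω ≤ b := fun i => by
    filter_upwards [hX0 i] with ω hω
    rw [hY, inv_mul_le_iff₀ hm0, mul_comm]
    linarith [hb i]
  have hYmean : ∀ i, ∫ ω, Y i ω ∂P = 0 := fun i => by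
    simp only [hY]
    rw [integral_const_mul, integral_sub (integrable_const _) ((hX i).integrable one_le_two)]
    simp
  have hYvar : ∑ i, variance (Y i) P = (∑ i, variance (X i) P) / m ^ 2 := by
    simp only [hY, variance_const_mul, variance_const_sub (hX _).aestronglyMeasurable]
    rw [← Finset.mul_sum, inv_pow, inv_mul_eq_div]
  have hset : {ω | ∑ i, X i ω ≤ m * (1 - r)} = {ω | r ≤ ∑ i, Y i ω} := by
    ext ω
    simp only [Set.mem_ofPred_eq, hY, ← Finset.mul_sum, Finset.sum_sub_distrib, hm]
    rw [le_inv_mul_iff₀ hm0, mul_one_sub, le_sub_comm]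
  rw [hset, ← hYvar]
  exact measureReal_le_sum_le_bennettTail hYind hYL hYb hb0 hYmean hr

end Bennett

theorem le_bennettH {a : ℝ} (ha : 0 ≤ a) : a ^ 2 / 2 / (1 + a / 3) ≤ bennettH a := by
  have hderiv : ∀ t : ℝ, 0 ≤ t → HasDerivAt (fun t => bennettH t - t ^ 2 / 2 / (1 + t / 3))
      (Real.log (1 + t) - (t + t ^ 2 / 6) / (1 + t / 3) ^ 2) t := by
    intro t ht
    have hadd : HasDerivAt (fun t : ℝ => 1 + t) 1 t := (hasDerivAt_id t).const_add 1
    have hlog : HasDerivAt (fun t : ℝ => Real.log (1 + t)) (1 / (1 + t)) t :=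
      hadd.log (by positivity)
    have hsq : HasDerivAt (fun t : ℝ => t ^ 2 / 2) t t :=
      ((hasDerivAt_pow 2 t).div_const 2).congr_deriv (by simp)
    have hden : HasDerivAt (fun t : ℝ => 1 + t / 3) (1 / 3) t :=
      ((hasDerivAt_id t).div_const 3).const_add 1
    refine (((hadd.mul hlog).sub (hasDerivAt_id t)).sub
      (hsq.div hden (by positivity))).congr_deriv ?_
    field_simp
    ring
  have hderiv_nonneg : ∀ t : ℝ, 0 ≤ t →
      0 ≤ Real.log (1 + t) - (t + t ^ 2 / 6) / (1 + t / 3) ^ 2 := by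
    intro t ht
    have hrat : (t + t ^ 2 / 6) / (1 + t / 3) ^ 2 ≤ 2 * t / (t + 2) := by
      rw [div_le_div_iff₀ (by positivity) (by positivity)]
      nlinarith [pow_nonneg ht 3]
    exact sub_nonneg.2 (hrat.trans (Real.le_log_one_add_of_nonneg ht))
  have hmono : MonotoneOn (fun t => bennettH t - t ^ 2 / 2 / (1 + t / 3)) (Set.Ici 0) :=
    monotoneOn_of_deriv_nonneg (convex_Ici 0)
      (fun t ht => (hderiv t ht).continuousAt.continuousWithinAt)
      (fun t ht => (hderiv t (interior_subset ht)).differentiableAt.differentiableWithinAt)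
      fun t ht => by
        rw [(hderiv t (interior_subset ht)).deriv]
        exact hderiv_nonneg t (interior_subset ht)
  simpa [bennettH] using hmono Set.self_mem_Ici ha ha

theorem fbt_le_fbn (s : ℕ) {μ ϱ r : ℝ} (hμ : 0 < μ) (hϱ : 0 ≤ ϱ) (hr : 0 < r) :
    fbt s μ ϱ r ≤ fbn s μ ϱ r := by
  unfold fbt fbn
  split_ifs with hϱ0
  · positivity
  have : 0 < ϱ := hϱ.lt_of_ne' hϱ0
  gcongr
  rw [neg_mul, neg_le_neg_iff]
  calc r ^ 2 / 2 / (μ * r / 3 + ϱ)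
      = ϱ / μ ^ 2 * ((μ * r / ϱ) ^ 2 / 2 / (1 + μ * r / ϱ / 3)) := by field_simp; ring
    _ ≤ ϱ / μ ^ 2 * bennettH (μ * r / ϱ) := by
        gcongr
        exact le_bennettH (by positivity)

section SlotEnergy

variable {Ω : Type*} [MeasurableSpace Ω] {P : Measure Ω} [IsProbabilityMeasure P]
  {N s Q : ℕ} (hN : N = s * Q)

theorem epoch_val (k : Fin s) (t : Fin Q) : (epoch hN k t : ℕ) = t + Q * k := by
  simp [epoch]

theorem epoch_injective (k : Fin s) : Function.Injective (epoch hN k) := by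
  intro t t' h
  have hval : (epoch hN k t : ℕ) = epoch hN k t' := congrArg Fin.val h
  rw [epoch_val, epoch_val] at hval
  exact Fin.ext (Nat.add_right_cancel hval)

include hN in
theorem natCast_div_slots (hs : s ≠ 0) : (N : ℝ) / s = Q := by
  rw [hN, Nat.cast_mul, mul_div_cancel_left₀ _ (Nat.cast_ne_zero.2 hs)]

theorem measureReal_slotEnergy_le {E : Fin N → Ω → ℝ} {μE ϱE b r : ℝ} (hQ : 0 < Q)
    (hEind : iIndepFun E P) (hEL : ∀ t, MemLp (E t) 2 P) (hE0 : ∀ t, ∀ᵐ ω ∂P, 0 ≤ E t ω)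
    (hEmean : ∀ t, ∫ ω, E t ω ∂P = μE) (hEvar : ∀ t, variance (E t) P = ϱE) (hμE : 0 < μE)
    (hb : (Q : ℝ)⁻¹ ≤ b) (hr : 0 < r) (k : Fin s) :
    P.real {ω | slotEnergy hN (fun t => E t ω) k ≤ μE * ((N : ℝ) / s) * (1 - r)} ≤
      bennettTail b (ϱE / μE ^ 2 * ((s : ℝ) / N)) r := by
  have hQR : (0 : ℝ) < Q := Nat.cast_pos.2 hQ
  have hmean : ∑ t : Fin Q, ∫ ω, E (epoch hN k t) ω ∂P = μE * Q := by
    simp [hEmean, mul_comm]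
  have hvar : (∑ t : Fin Q, variance (E (epoch hN k t)) P) / (μE * Q) ^ 2 =
      ϱE / μE ^ 2 * ((s : ℝ) / N) := by
    rw [← inv_div (N : ℝ), natCast_div_slots hN k.pos.ne']
    simp only [hEvar, Finset.sum_const, Finset.card_univ, Fintype.card_fin, nsmul_eq_mul]
    field_simp
  have hle : μE ≤ b * (μE * Q) := by
    calc μE = (Q : ℝ)⁻¹ * (μE * Q) := by field_simp
      _ ≤ b * (μE * Q) := by gcongr
  rw [natCast_div_slots hN k.pos.ne', ← hvar]
  exact measureReal_sum_le_le_bennettTail (hEind.precomp (epoch_injective hN k))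
    (fun t => hEL _) (fun t => hE0 _) hmean (by positivity) (fun t => (hEmean _).trans_le hle)
    ((inv_pos.2 hQR).trans_le hb) hr

end SlotEnergy

section LinearEstimation

theorem norm_toLp_sq_eq_integral {Ω E : Type*} [MeasurableSpace Ω] {P : Measure Ω}
    [NormedAddCommGroup E] {f : Ω → E} (hf : MemLp f 2 P) :
    ‖hf.toLp f‖ ^ 2 = ∫ ω, ‖f ω‖ ^ 2 ∂P := by
  have hint : 0 ≤ ∫ ω, ‖f ω‖ ^ 2 ∂P := integral_nonneg fun ω => sq_nonneg _
  rw [Lp.norm_toLp, toReal_eLpNorm hf.1, lpNorm_eq_integral_norm_rpow_toReal two_ne_zero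
    ENNReal.ofNat_ne_top hf.1]
  simp only [ENNReal.toReal_ofNat, Real.rpow_ofNat]
  rw [← Real.rpow_natCast, Nat.cast_ofNat, Real.rpow_inv_rpow hint two_ne_zero]

theorem integral_norm_sub_condExp_sq_le (𝕜 : Type*) [RCLike 𝕜] {Ω E : Type*}
    {m m0 : MeasurableSpace Ω} {P : Measure Ω} [IsFiniteMeasure P] [NormedAddCommGroup E]
    [InnerProductSpace 𝕜 E] [NormedSpace ℝ E] [CompleteSpace E] (hm : m ≤ m0) {f g : Ω → E}
    (hf : MemLp f 2 P) (hg : MemLp g 2 P) (hgm : AEStronglyMeasurable[m] g P) :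
    ∫ ω, ‖f ω - (P[f | m]) ω‖ ^ 2 ∂P ≤ ∫ ω, ‖f ω - g ω‖ ^ 2 ∂P := by
  have : Fact (m ≤ m0) := ⟨hm⟩
  have hgmem : hg.toLp g ∈ lpMeas E 𝕜 m 2 P := by
    rw [mem_lpMeas_iff_aestronglyMeasurable]
    exact hgm.congr hg.coeFn_toLp.symm
  have hproj : (condExpL2 E 𝕜 hm (hf.toLp f) : Lp E 2 P) =ᵐ[P] P[f | m] :=
    hf.condExpL2_ae_eq_condExp (𝕜 := 𝕜) hm
  have hcond : MemLp (P[f | m]) 2 P := (memLp_congr_ae hproj).1 (Lp.memLp _)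
  have hproj' : hcond.toLp _ = (lpMeas E 𝕜 m 2 P).starProjection (hf.toLp f) :=
    Lp.ext (hcond.coeFn_toLp.trans hproj.symm)
  calc ∫ ω, ‖f ω - (P[f | m]) ω‖ ^ 2 ∂P = ‖hf.toLp f - hcond.toLp _‖ ^ 2 := by
        rw [← MemLp.toLp_sub hf hcond, norm_toLp_sq_eq_integral]
        rfl
    _ ≤ ‖hf.toLp f - hg.toLp g‖ ^ 2 := by
        gcongr
        rw [hproj', Submodule.starProjection_minimal]
        exact ciInf_le ⟨0, by rintro _ ⟨z, rfl⟩; exact norm_nonneg _⟩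
          (⟨hg.toLp g, hgmem⟩ : lpMeas E 𝕜 m 2 P)
    _ = ∫ ω, ‖f ω - g ω‖ ^ 2 ∂P := by
        rw [← MemLp.toLp_sub hf hg, norm_toLp_sq_eq_integral]
        rfl

variable {Ω ι κ ν : Type*} [MeasurableSpace Ω] {P : Measure Ω}

/-- The correlation matrix `E[X Y†]` of two complex random vectors. An entry is `0` if the product
of the two components is not integrable. -/
noncomputable def crossCorrelation (P : Measure Ω) (X : Ω → EuclideanSpace ℂ ι)
    (Y : Ω → EuclideanSpace ℂ κ) : Matrix ι κ ℂ :=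
  Matrix.of fun i j => ∫ ω, X ω i * star (Y ω j) ∂P

theorem conjTranspose_crossCorrelation (X : Ω → EuclideanSpace ℂ ι) (Y : Ω → EuclideanSpace ℂ κ) :
    (crossCorrelation P X Y).conjTranspose = crossCorrelation P Y X := by
  ext j i
  refine (integral_conj (𝕜 := ℂ)).symm.trans ?_
  simp [crossCorrelation, mul_comm]

theorem ofReal_integral_norm_sq_apply (X : Ω → EuclideanSpace ℂ ι) (i : ι) :
    ((∫ ω, ‖X ω i‖ ^ 2 ∂P : ℝ) : ℂ) = crossCorrelation P X X i i := by
  simp only [crossCorrelation, Matrix.of_apply, Complex.star_def, Complex.mul_conj',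
    ← integral_complex_ofReal, Complex.ofReal_pow]

variable [Fintype ι] [Fintype κ] {X X' : Ω → EuclideanSpace ℂ ι}
  {Y Y' : Ω → EuclideanSpace ℂ κ}

theorem integrable_apply_mul_star_apply (hX : MemLp X 2 P) (hY : MemLp Y 2 P) (i : ι) (j : κ) :
    Integrable (fun ω => X ω i * star (Y ω j)) P :=
  (hX.eval_piLp i).integrable_mul (hY.eval_piLp j).star

theorem trace_crossCorrelation_self (hX : MemLp X 2 P) :
    (crossCorrelation P X X).trace = ((∫ ω, ‖X ω‖ ^ 2 ∂P : ℝ) : ℂ) := by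
  simp only [EuclideanSpace.norm_sq_eq]
  rw [integral_finsetSum _ fun i _ => (hX.eval_piLp i).integrable_norm_pow two_ne_zero,
    Complex.ofReal_sum]
  exact Finset.sum_congr rfl fun i _ => (ofReal_integral_norm_sq_apply X i).symm

theorem crossCorrelation_add_left (hX : MemLp X 2 P) (hX' : MemLp X' 2 P) (hY : MemLp Y 2 P) :
    crossCorrelation P (fun ω => X ω + X' ω) Y =
      crossCorrelation P X Y + crossCorrelation P X' Y := by
  ext i j
  simp only [crossCorrelation, Matrix.of_apply, Matrix.add_apply, PiLp.add_apply, add_mul]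
  exact integral_add (integrable_apply_mul_star_apply hX hY i j)
    (integrable_apply_mul_star_apply hX' hY i j)

theorem crossCorrelation_add_right (hX : MemLp X 2 P) (hY : MemLp Y 2 P) (hY' : MemLp Y' 2 P) :
    crossCorrelation P X (fun ω => Y ω + Y' ω) =
      crossCorrelation P X Y + crossCorrelation P X Y' := by
  rw [← conjTranspose_crossCorrelation, crossCorrelation_add_left hY hY' hX,
    Matrix.conjTranspose_add, conjTranspose_crossCorrelation, conjTranspose_crossCorrelation]

theorem crossCorrelation_sub_left (hX : MemLp X 2 P) (hX' : MemLp X' 2 P) (hY : MemLp Y 2 P) :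
    crossCorrelation P (fun ω => X ω - X' ω) Y =
      crossCorrelation P X Y - crossCorrelation P X' Y := by
  ext i j
  simp only [crossCorrelation, Matrix.of_apply, Matrix.sub_apply, PiLp.sub_apply, sub_mul]
  exact integral_sub (integrable_apply_mul_star_apply hX hY i j)
    (integrable_apply_mul_star_apply hX' hY i j)

theorem crossCorrelation_sub_right (hX : MemLp X 2 P) (hY : MemLp Y 2 P) (hY' : MemLp Y' 2 P) :
    crossCorrelation P X (fun ω => Y ω - Y' ω) =
      crossCorrelation P X Y - crossCorrelation P X Y' := by
  rw [← conjTranspose_crossCorrelation, crossCorrelation_sub_left hY hY' hX,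
    Matrix.conjTranspose_sub, conjTranspose_crossCorrelation, conjTranspose_crossCorrelation]

theorem memLp_toEuclideanLin [DecidableEq ι] [Fintype ν] {p : ENNReal} (A : Matrix ν ι ℂ)
    (hX : MemLp X p P) :
    MemLp (fun ω => A.toEuclideanLin (X ω)) p P :=
  A.toEuclideanLin.toContinuousLinearMap.comp_memLp' hX

theorem crossCorrelation_toEuclideanLin_left [DecidableEq ι] (A : Matrix ν ι ℂ)
    (hX : MemLp X 2 P) (hY : MemLp Y 2 P) :
    crossCorrelation P (fun ω => A.toEuclideanLin (X ω)) Y = A * crossCorrelation P X Y := by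
  ext i j
  simp only [crossCorrelation, Matrix.of_apply, Matrix.mul_apply, Matrix.toLpLin_apply,
    Matrix.mulVec, dotProduct, Finset.sum_mul, mul_assoc]
  rw [integral_finsetSum _ fun l _ =>
    (integrable_apply_mul_star_apply hX hY l j).const_mul (A i l)]
  simp only [integral_const_mul]

theorem crossCorrelation_toEuclideanLin_right [DecidableEq κ] (A : Matrix ν κ ℂ)
    (hX : MemLp X 2 P) (hY : MemLp Y 2 P) :
    crossCorrelation P X (fun ω => A.toEuclideanLin (Y ω)) =
      crossCorrelation P X Y * A.conjTranspose := by
  rw [← conjTranspose_crossCorrelation, crossCorrelation_toEuclideanLin_left A hY hX,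
    Matrix.conjTranspose_mul, conjTranspose_crossCorrelation]

/- The hypothesis is the normal equation (orthogonality principle): `B` gives the best linear
estimator of `X` from `Y`. -/
theorem integral_norm_sub_toEuclideanLin_sq [DecidableEq κ] {B : Matrix ι κ ℂ}
    (hX : MemLp X 2 P) (hY : MemLp Y 2 P)
    (hB : B * crossCorrelation P Y Y = crossCorrelation P X Y) :
    ((∫ ω, ‖X ω - B.toEuclideanLin (Y ω)‖ ^ 2 ∂P : ℝ) : ℂ) =
      (crossCorrelation P X X - B * crossCorrelation P Y X).trace := by
  have hBY := memLp_toEuclideanLin B hY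
  have hXBY : MemLp (fun ω => X ω - B.toEuclideanLin (Y ω)) 2 P := hX.sub hBY
  have horth : crossCorrelation P (fun ω => X ω - B.toEuclideanLin (Y ω)) Y = 0 := by
    rw [crossCorrelation_sub_left hX hBY hY, crossCorrelation_toEuclideanLin_left B hY hY, hB,
      sub_self]
  rw [← trace_crossCorrelation_self hXBY, crossCorrelation_sub_right hXBY hX hBY,
    crossCorrelation_toEuclideanLin_right B hXBY hY, horth, Matrix.zero_mul, sub_zero,
    crossCorrelation_sub_left hX hBY hX, crossCorrelation_toEuclideanLin_left B hY hX]

end LinearEstimation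

section LinearChannel

variable {Ω : Type*} [MeasurableSpace Ω] {P : Measure Ω} {N m : ℕ}
  {x : Ω → EuclideanSpace ℂ (Fin N)} {w : Ω → EuclideanSpace ℂ (Fin m)}

theorem mmse_le_of_normalEquation [IsFiniteMeasure P] {y : Ω → EuclideanSpace ℂ (Fin m)}
    {B : Matrix (Fin N) (Fin m) ℂ} (hx : MemLp x 2 P) (hy : MemLp y 2 P) (hym : Measurable y)
    (hB : B * crossCorrelation P y y = crossCorrelation P x y) :
    mmse P x y ≤ (crossCorrelation P x x - B * crossCorrelation P y x).trace.re := by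
  rw [← integral_norm_sub_toEuclideanLin_sq hx hy hB, Complex.ofReal_re]
  have hBm : StronglyMeasurable[MeasurableSpace.comap y inferInstance]
      (fun ω => B.toEuclideanLin (y ω)) :=
    B.toEuclideanLin.toContinuousLinearMap.continuous.stronglyMeasurable.comp_measurable
      (comap_measurable y)
  exact integral_norm_sub_condExp_sq_le ℂ hym.comap_le hx (memLp_toEuclideanLin B hy)
    hBm.aestronglyMeasurable

theorem crossCorrelation_channelOutput_right (H : Matrix (Fin m) (Fin N) ℂ) (hx : MemLp x 2 P)
    (hw : MemLp w 2 P) (hxw : crossCorrelation P x w = 0) :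
    crossCorrelation P x (fun ω => H.toEuclideanLin (x ω) + w ω) =
      crossCorrelation P x x * H.conjTranspose := by
  rw [crossCorrelation_add_right hx (memLp_toEuclideanLin H hx) hw,
    crossCorrelation_toEuclideanLin_right H hx hx, hxw, add_zero]

theorem crossCorrelation_channelOutput_self (H : Matrix (Fin m) (Fin N) ℂ) (hx : MemLp x 2 P)
    (hw : MemLp w 2 P) (hxw : crossCorrelation P x w = 0) :
    crossCorrelation P (fun ω => H.toEuclideanLin (x ω) + w ω)
        (fun ω => H.toEuclideanLin (x ω) + w ω) =
      H * crossCorrelation P x x * H.conjTranspose + crossCorrelation P w w := by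
  have hHx := memLp_toEuclideanLin H hx
  have hwx : crossCorrelation P w x = 0 := by
    rw [← conjTranspose_crossCorrelation, hxw, Matrix.conjTranspose_zero]
  have hy : MemLp (fun ω => H.toEuclideanLin (x ω) + w ω) 2 P := hHx.add hw
  rw [crossCorrelation_add_left hHx hw hy, crossCorrelation_add_right hw hHx hw,
    crossCorrelation_toEuclideanLin_left H hx hy, crossCorrelation_toEuclideanLin_right H hw hx,
    hwx, Matrix.zero_mul, zero_add, crossCorrelation_channelOutput_right H hx hw hxw,
    Matrix.mul_assoc]

theorem trace_mul_mul_diagonal_mul_of_mul_self_eq_smul {R l n : Type*} [CommSemiring R] [Fintype l]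
    [Fintype n] [DecidableEq l] {K : Matrix n n R} {H : Matrix l n R} {G : Matrix n l R} {c : R}
    {d e : l → R} (hK : K * K = c • K) (hHG : H * K * G = Matrix.diagonal d) :
    (K * G * Matrix.diagonal e * (H * K)).trace = ∑ k, e k * (c * d k) := by
  calc (K * G * Matrix.diagonal e * (H * K)).trace
      = (Matrix.diagonal e * (H * (K * K) * G)).trace := by
        rw [Matrix.mul_assoc, Matrix.trace_mul_comm]
        simp only [Matrix.mul_assoc]
    _ = ∑ k, e k * (c * d k) := by
        rw [hK, Matrix.mul_smul, Matrix.smul_mul, hHG, ← Matrix.diagonal_smul,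
          Matrix.diagonal_mul_diagonal, Matrix.trace_diagonal]
        rfl

/- A flat spectrum `K * K = c • K` and uncorrelated channel outputs decouple the linear estimator:
the `k`-th output removes the error `c d_k / (d_k + n_k)`. -/
theorem mmse_channelOutput_le [IsFiniteMeasure P] {H : Matrix (Fin m) (Fin N) ℂ}
    {K : Matrix (Fin N) (Fin N) ℂ} {c : ℝ} {d n : Fin m → ℝ} (hx : MemLp x 2 P)
    (hw : MemLp w 2 P) (hxm : Measurable x) (hwm : Measurable w)
    (hxx : crossCorrelation P x x = K) (hxw : crossCorrelation P x w = 0)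
    (hww : crossCorrelation P w w = Matrix.diagonal fun k => (n k : ℂ))
    (hKK : K * K = (c : ℂ) • K)
    (hHK : H * K * H.conjTranspose = Matrix.diagonal fun k => (d k : ℂ))
    (hdn : ∀ k, d k + n k ≠ 0) :
    mmse P x (fun ω => H.toEuclideanLin (x ω) + w ω) ≤
      K.trace.re - ∑ k, c * d k / (d k + n k) := by
  set y : Ω → EuclideanSpace ℂ (Fin m) := fun ω => H.toEuclideanLin (x ω) + w ω
  set D : Matrix (Fin m) (Fin m) ℂ := Matrix.diagonal fun k => ((d k + n k : ℝ) : ℂ)⁻¹ with hD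
  have hy : MemLp y 2 P := (memLp_toEuclideanLin H hx).add hw
  have hym : Measurable y :=
    (H.toEuclideanLin.toContinuousLinearMap.continuous.measurable.comp hxm).add hwm
  have hxy : crossCorrelation P x y = K * H.conjTranspose :=
    hxx ▸ crossCorrelation_channelOutput_right H hx hw hxw
  have hyx : crossCorrelation P y x = H * K := by
    rw [← conjTranspose_crossCorrelation, hxy, Matrix.conjTranspose_mul,
      Matrix.conjTranspose_conjTranspose, ← hxx, conjTranspose_crossCorrelation]
  have hyy : D * crossCorrelation P y y = 1 := by
    rw [crossCorrelation_channelOutput_self H hx hw hxw, hxx, hHK, hww, Matrix.diagonal_add, hD,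
      Matrix.diagonal_mul_diagonal, ← Matrix.diagonal_one]
    congr 1
    ext k
    rw [← Complex.ofReal_add, inv_mul_cancel₀ (Complex.ofReal_ne_zero.2 (hdn k))]
  have htrace : (K * H.conjTranspose * D * (H * K)).trace =
      ((∑ k, c * d k / (d k + n k) : ℝ) : ℂ) := by
    rw [hD, trace_mul_mul_diagonal_mul_of_mul_self_eq_smul hKK hHK, Complex.ofReal_sum]
    refine Finset.sum_congr rfl fun k _ => ?_
    rw [Complex.ofReal_div, Complex.ofReal_mul, div_eq_inv_mul]
  have h := mmse_le_of_normalEquation (B := K * H.conjTranspose * D) hx hy hym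
    (by rw [Matrix.mul_assoc, hyy, Matrix.mul_one, hxy])
  rwa [hxx, hyx, Matrix.trace_sub, Complex.sub_re, htrace, Complex.ofReal_re] at h

end LinearChannel

section LowPass

/-- The primitive `N`-th root of unity `e^{-2πi/N}` whose powers are the entries of the discrete
Fourier transform matrix. -/
noncomputable def dftRoot (N : ℕ) : ℂ :=
  (Complex.exp (2 * Real.pi * Complex.I / N))⁻¹

theorem isPrimitiveRoot_dftRoot {N : ℕ} (hN : N ≠ 0) : IsPrimitiveRoot (dftRoot N) N :=
  (Complex.isPrimitiveRoot_exp N hN).inv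

theorem dftMatrix_apply {N : ℕ} (t k : Fin N) :
    dftMatrix N t k = (Real.sqrt N : ℂ)⁻¹ * dftRoot N ^ ((t : ℕ) * k) := by
  rw [dftMatrix, Matrix.of_apply, one_div, dftRoot, ← Complex.exp_neg, ← Complex.exp_nat_mul]
  congr 2
  push_cast
  ring

theorem dftMatrix_mul_star {N : ℕ} (t u f : Fin N) :
    dftMatrix N t f * star (dftMatrix N u f) =
      (N : ℂ)⁻¹ * (dftRoot N ^ ((t : ℕ) * f) * star (dftRoot N ^ ((u : ℕ) * f))) := by
  have hsqrt : (Real.sqrt N : ℂ)⁻¹ * (Real.sqrt N : ℂ)⁻¹ = (N : ℂ)⁻¹ := by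
    rw [← mul_inv, ← Complex.ofReal_mul, Real.mul_self_sqrt (Nat.cast_nonneg N),
      Complex.ofReal_natCast]
  rw [dftMatrix_apply, dftMatrix_apply, star_mul', star_inv₀, Complex.star_def,
    Complex.conj_ofReal, mul_mul_mul_comm, hsqrt]

theorem star_eq_inv_of_isPrimitiveRoot {n : ℕ} {ζ : ℂ} (hζ : IsPrimitiveRoot ζ n) (hn : n ≠ 0) :
    star ζ = ζ⁻¹ :=
  (Complex.inv_eq_conj (hζ.norm'_eq_one hn)).symm

theorem sum_pow_mul_star_pow_of_isPrimitiveRoot {n a b : ℕ} {ζ : ℂ} (hζ : IsPrimitiveRoot ζ n)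
    (ha : a < n) (hb : b < n) :
    ∑ f ∈ Finset.range n, ζ ^ (a * f) * star (ζ ^ (b * f)) = if a = b then (n : ℂ) else 0 := by
  have hn : n ≠ 0 := (Nat.zero_le a).trans_lt ha |>.ne'
  have hζ0 : ζ ≠ 0 := hζ.ne_zero hn
  have hterm : ∀ f, ζ ^ (a * f) * star (ζ ^ (b * f)) = (ζ ^ a / ζ ^ b) ^ f := by
    intro f
    rw [star_pow, star_eq_inv_of_isPrimitiveRoot hζ hn, inv_pow, div_pow, ← pow_mul, ← pow_mul,
      div_eq_mul_inv]
  simp only [hterm]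
  split_ifs with hab
  · simp [hab, hζ0]
  · have hne : ζ ^ a / ζ ^ b ≠ 1 := fun h =>
      hab (hζ.pow_inj ha hb ((div_eq_one_iff_eq (pow_ne_zero b hζ0)).1 h))
    have hpow : (ζ ^ a / ζ ^ b) ^ n = 1 := by
      rw [div_pow, pow_right_comm, pow_right_comm ζ b, hζ.pow_eq_one, one_pow, one_pow, div_one]
    rw [geom_sum_eq hne, hpow, sub_self, zero_div]

theorem dftMatrix_mul_conjTranspose (N : ℕ) : dftMatrix N * (dftMatrix N).conjTranspose = 1 := by
  ext t u
  have hN : N ≠ 0 := t.pos.ne'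
  simp only [Matrix.mul_apply, Matrix.conjTranspose_apply, dftMatrix_mul_star, ← Finset.mul_sum]
  rw [← Finset.sum_range fun f : ℕ =>
      dftRoot N ^ ((t : ℕ) * f) * star (dftRoot N ^ ((u : ℕ) * f)),
    sum_pow_mul_star_pow_of_isPrimitiveRoot (isPrimitiveRoot_dftRoot hN) t.2 u.2, Matrix.one_apply]
  simp [Fin.val_inj, hN]

namespace IsLowPassCWSS

variable {N s Q : ℕ} {Px : ℝ} {K : Matrix (Fin N) (Fin N) ℂ}

theorem mul_dftMatrix (hK : IsLowPassCWSS s Px K) :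
    K * dftMatrix N = dftMatrix N * Matrix.diagonal
      (fun k : Fin N => if (k : ℕ) < s then ((Px / s : ℝ) : ℂ) else 0) := by
  ext t k
  rw [Matrix.mul_diagonal, mul_comm (dftMatrix N t k)]
  exact congrFun (hK.low_pass k) t

theorem eq_dftMatrix_mul_diagonal_mul (hK : IsLowPassCWSS s Px K) :
    K = dftMatrix N * Matrix.diagonal
      (fun k : Fin N => if (k : ℕ) < s then ((Px / s : ℝ) : ℂ) else 0) *
        (dftMatrix N).conjTranspose := by
  rw [← hK.mul_dftMatrix, Matrix.mul_assoc, dftMatrix_mul_conjTranspose, Matrix.mul_one]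

theorem mul_self (hK : IsLowPassCWSS s Px K) : K * K = ((Px / s : ℝ) : ℂ) • K := by
  set D := Matrix.diagonal (fun k : Fin N => if (k : ℕ) < s then ((Px / s : ℝ) : ℂ) else 0) with hD
  have hDD : D * D = ((Px / s : ℝ) : ℂ) • D := by
    rw [hD, Matrix.diagonal_mul_diagonal, ← Matrix.diagonal_smul]
    congr 1
    ext k
    simp only [Pi.smul_apply, smul_eq_mul]
    split_ifs
    · rfl
    · rw [mul_zero, mul_zero]
  have hKU : K * dftMatrix N = dftMatrix N * D := hK.mul_dftMatrix
  calc K * K = K * dftMatrix N * D * (dftMatrix N).conjTranspose := by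
        conv_lhs => rw [hK.eq_dftMatrix_mul_diagonal_mul, ← hD]
        conv_rhs => rw [hK.eq_dftMatrix_mul_diagonal_mul, ← hD]
        simp only [Matrix.mul_assoc]
    _ = dftMatrix N * (D * D) * (dftMatrix N).conjTranspose := by
        rw [hKU, Matrix.mul_assoc (dftMatrix N)]
    _ = ((Px / s : ℝ) : ℂ) • K := by
        rw [hDD, Matrix.mul_smul, Matrix.smul_mul, ← hK.eq_dftMatrix_mul_diagonal_mul]

theorem slots_pos (hK : IsLowPassCWSS s Px K) (hN : N = s * Q) (hPx : Px ≠ 0) : 0 < s := by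
  refine Nat.pos_of_ne_zero ?_
  rintro rfl
  obtain rfl : N = 0 := hN.trans (zero_mul Q)
  exact hPx (Complex.ofReal_eq_zero.1 (hK.trace_eq.symm.trans (Matrix.trace_fin_zero K)))

theorem apply_eq_sum (hK : IsLowPassCWSS s Px K) (hs : s ≤ N) (t u : Fin N) :
    K t u = ((Px / s : ℝ) : ℂ) * (N : ℂ)⁻¹ *
      ∑ f ∈ Finset.range s, dftRoot N ^ ((t : ℕ) * f) * star (dftRoot N ^ ((u : ℕ) * f)) := by
  have hfilter : (Finset.range N).filter (· < s) = Finset.range s := by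
    ext f
    simp only [Finset.mem_filter, Finset.mem_range]
    exact and_iff_right_of_imp fun h => h.trans_le hs
  rw [← hfilter, Finset.sum_filter, Finset.sum_range, Finset.mul_sum]
  conv_lhs => rw [hK.eq_dftMatrix_mul_diagonal_mul]
  rw [Matrix.mul_apply]
  refine Finset.sum_congr rfl fun f _ => ?_
  rw [Matrix.mul_diagonal, Matrix.conjTranspose_apply, mul_right_comm, dftMatrix_mul_star]
  split_ifs <;> ring

/- The phase of the common offset `td` cancels, and `dftRoot N ^ Q` is a primitive `s`-th root of
unity: sampling at the Nyquist rate turns the first `s` columns of the DFT of size `N` into the DFT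
of size `s`. -/
theorem submatrix_epoch (hK : IsLowPassCWSS s Px K) (hN : N = s * Q) (td : Fin Q) :
    K.submatrix (fun k => epoch hN k td) (fun k => epoch hN k td) =
      ((Px / N : ℝ) : ℂ) • (1 : Matrix (Fin s) (Fin s) ℂ) := by
  ext k l
  have hN0 : N ≠ 0 := (epoch hN k td).pos.ne'
  have hs : (s : ℂ) ≠ 0 := Nat.cast_ne_zero.2 k.pos.ne'
  have hζ : IsPrimitiveRoot (dftRoot N) N := isPrimitiveRoot_dftRoot hN0
  have hζQ : IsPrimitiveRoot (dftRoot N ^ Q) s :=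
    hζ.pow (Nat.pos_of_ne_zero hN0) (hN.trans (mul_comm s Q))
  have hphase : ∀ f : ℕ,
      dftRoot N ^ ((epoch hN k td : ℕ) * f) * star (dftRoot N ^ ((epoch hN l td : ℕ) * f)) =
        (dftRoot N ^ Q) ^ ((k : ℕ) * f) * star ((dftRoot N ^ Q) ^ ((l : ℕ) * f)) := by
    intro f
    have hroot : dftRoot N ≠ 0 := hζ.ne_zero hN0
    have hoffset : dftRoot N ^ ((td : ℕ) * f) * star (dftRoot N ^ ((td : ℕ) * f)) = 1 := by
      rw [star_pow, star_eq_inv_of_isPrimitiveRoot hζ hN0, inv_pow,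
        mul_inv_cancel₀ (pow_ne_zero _ hroot)]
    rw [epoch_val, epoch_val, add_mul, add_mul, pow_add, pow_add, star_mul', mul_mul_mul_comm,
      hoffset, one_mul, mul_assoc Q, mul_assoc Q, pow_mul, pow_mul _ Q]
  rw [Matrix.submatrix_apply, hK.apply_eq_sum (hN ▸ Nat.le_mul_of_pos_right s td.pos),
    Finset.sum_congr rfl fun f _ => hphase f,
    sum_pow_mul_star_pow_of_isPrimitiveRoot hζQ k.2 l.2, Matrix.smul_apply, Matrix.one_apply,
    smul_eq_mul]
  simp only [Fin.val_inj]
  split_ifs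
  · push_cast
    field_simp
  · simp

end IsLowPassCWSS

end LowPass

section Scheme

variable {Ω : Type*} {N s Q : ℕ} (hN : N = s * Q) (td : Fin Q)
  {x : Ω → EuclideanSpace ℂ (Fin N)} {w : Ω → EuclideanSpace ℂ (Fin s)}

/-- The matrix `H` of the channel `y = H x + w`: it selects the samples sent at the end of the slots
and amplifies the `k`-th one by `√(p k)`. -/
noncomputable def samplingMatrix (p : Fin s → ℝ) : Matrix (Fin s) (Fin N) ℂ :=
  Matrix.diagonal (fun k => (Real.sqrt (p k) : ℂ)) *
    (1 : Matrix (Fin N) (Fin N) ℂ).submatrix (fun k => epoch hN k td) id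

theorem received_eq_samplingMatrix (p : Fin s → ℝ) :
    received hN td x w p =
      fun ω => (samplingMatrix hN td p).toEuclideanLin (x ω) + w ω := by
  ext ω k
  simp only [samplingMatrix, PiLp.add_apply, Matrix.toLpLin_apply, ← Matrix.mulVec_mulVec,
    Matrix.mulVec_diagonal]
  simp [received, Matrix.mulVec, dotProduct, Matrix.one_apply]

variable [MeasurableSpace Ω] {P : Measure Ω} {K : Matrix (Fin N) (Fin N) ℂ} {Px σw : ℝ}

theorem usedEnergy_eq (hK : IsLowPassCWSS s Px K) (hxx : crossCorrelation P x x = K) (k : Fin s)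
    (p : ℝ) : usedEnergy P hN td x k p = Real.sqrt p ^ 2 * (Px / N) := by
  have hsample : ∫ ω, ‖x ω (epoch hN k td)‖ ^ 2 ∂P = Px / N := by
    have hdiag := congrFun (congrFun (hK.submatrix_epoch hN td) k) k
    rw [Matrix.submatrix_apply, ← hxx, ← ofReal_integral_norm_sq_apply, Matrix.smul_apply,
      Matrix.one_apply_eq, smul_eq_mul, mul_one] at hdiag
    exact Complex.ofReal_injective hdiag
  simp only [usedEnergy, norm_mul, mul_pow, Complex.norm_real, Real.norm_eq_abs, sq_abs]
  rw [integral_const_mul, hsample]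

theorem samplingMatrix_mul_mul_conjTranspose (hK : IsLowPassCWSS s Px K)
    (hxx : crossCorrelation P x x = K) (p : Fin s → ℝ) :
    samplingMatrix hN td p * K * (samplingMatrix hN td p).conjTranspose =
      Matrix.diagonal fun k => (usedEnergy P hN td x k (p k) : ℂ) := by
  set A := Matrix.diagonal (fun k => (Real.sqrt (p k) : ℂ)) with hA
  set e : Fin s → Fin N := fun k => epoch hN k td with he
  have hselect : (1 : Matrix (Fin N) (Fin N) ℂ).submatrix e id * K *
      ((1 : Matrix (Fin N) (Fin N) ℂ).submatrix e id).conjTranspose = K.submatrix e e := by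
    ext k l
    simp [Matrix.mul_apply, Matrix.one_apply]
  calc samplingMatrix hN td p * K * (samplingMatrix hN td p).conjTranspose
      = A * ((1 : Matrix (Fin N) (Fin N) ℂ).submatrix e id * K *
          ((1 : Matrix (Fin N) (Fin N) ℂ).submatrix e id).conjTranspose) * A.conjTranspose := by
        simp only [samplingMatrix, Matrix.conjTranspose_mul, Matrix.mul_assoc, hA, he]
    _ = Matrix.diagonal fun k => (usedEnergy P hN td x k (p k) : ℂ) := by
        rw [hselect, hK.submatrix_epoch hN td, Matrix.mul_smul, Matrix.mul_one, Matrix.smul_mul,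
          hA, Matrix.diagonal_conjTranspose, Matrix.diagonal_mul_diagonal, ← Matrix.diagonal_smul]
        congr 1
        ext k
        rw [usedEnergy_eq hN td hK hxx]
        simp
        ring

theorem mmse_received_le [IsFiniteMeasure P] (hK : IsLowPassCWSS s Px K) (hσw : σw ≠ 0)
    (hPx : Px ≠ 0) (hxm : Measurable x) (hx : MemLp x 2 P) (hxx : crossCorrelation P x x = K)
    (hwm : Measurable w) (hw : MemLp w 2 P)
    (hww : crossCorrelation P w w = ((σw ^ 2 : ℝ) : ℂ) • 1) (hxw : crossCorrelation P x w = 0)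
    (p : Fin s → ℝ) :
    mmse P x (received hN td x w p) ≤
      ∑ k, Px / s * (1 / (1 + 1 / σw ^ 2 * usedEnergy P hN td x k (p k))) := by
  have hs : (s : ℝ) ≠ 0 := Nat.cast_ne_zero.2 (hK.slots_pos hN hPx).ne'
  have hden : ∀ k, 0 < usedEnergy P hN td x k (p k) + σw ^ 2 := fun k =>
    add_pos_of_nonneg_of_pos (integral_nonneg fun _ => sq_nonneg _) (by positivity)
  have h := mmse_channelOutput_le (n := fun _ => σw ^ 2) hx hw hxm hwm hxx hxw
    (by rw [hww, Matrix.smul_one_eq_diagonal]) hK.mul_self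
    (samplingMatrix_mul_mul_conjTranspose hN td hK hxx p) fun k => (hden k).ne'
  rw [← received_eq_samplingMatrix, hK.trace_eq, Complex.ofReal_re] at h
  refine h.trans_eq ?_
  calc Px - ∑ k, Px / s * usedEnergy P hN td x k (p k) /
          (usedEnergy P hN td x k (p k) + σw ^ 2)
      = ∑ k, (Px / s - Px / s * usedEnergy P hN td x k (p k) /
          (usedEnergy P hN td x k (p k) + σw ^ 2)) := by
        rw [Finset.sum_sub_distrib, Finset.sum_const, Finset.card_univ, Fintype.card_fin,
          nsmul_eq_mul, mul_div_cancel₀ _ hs]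
    _ = ∑ k, Px / s * (1 / (1 + 1 / σw ^ 2 * usedEnergy P hN td x k (p k))) := by
        refine Finset.sum_congr rfl fun k _ => ?_
        have hden' := (hden k).ne'
        have hden'' : σw ^ 2 + usedEnergy P hN td x k (p k) ≠ 0 := by rwa [add_comm]
        field_simp
        ring

theorem mmse_received_lt [IsFiniteMeasure P] (hK : IsLowPassCWSS s Px K) (hσw : σw ≠ 0)
    (hPx : 0 < Px) (hxm : Measurable x) (hx : MemLp x 2 P) (hxx : crossCorrelation P x x = K)
    (hwm : Measurable w) (hw : MemLp w 2 P)
    (hww : crossCorrelation P w w = ((σw ^ 2 : ℝ) : ℂ) • 1) (hxw : crossCorrelation P x w = 0)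
    {p : Fin s → ℝ} {c : ℝ} (hc : 0 ≤ c) (hp : ∀ k, c < usedEnergy P hN td x k (p k)) :
    mmse P x (received hN td x w p) < 1 / (1 + 1 / σw ^ 2 * c) * Px := by
  have hs : 0 < s := hK.slots_pos hN hPx.ne'
  have : Nonempty (Fin s) := ⟨⟨0, hs⟩⟩
  calc mmse P x (received hN td x w p)
      ≤ ∑ k, Px / s * (1 / (1 + 1 / σw ^ 2 * usedEnergy P hN td x k (p k))) :=
        mmse_received_le hN td hK hσw hPx.ne' hxm hx hxx hwm hw hww hxw p
    _ < ∑ _k : Fin s, Px / s * (1 / (1 + 1 / σw ^ 2 * c)) := by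
        refine Finset.sum_lt_sum_of_nonempty Finset.univ_nonempty fun k _ => ?_
        have := hp k
        gcongr
    _ = 1 / (1 + 1 / σw ^ 2 * c) * Px := by
        rw [Finset.sum_const, Finset.card_univ, Fintype.card_fin, nsmul_eq_mul]
        field_simp

end Scheme

theorem one_sub_sum_le_measureReal {Ω ι : Type*} [MeasurableSpace Ω] {P : Measure Ω}
    [IsProbabilityMeasure P] [Fintype ι] {A : ι → Set Ω} {B : Set Ω}
    (h : ∀ᵐ ω ∂P, (∀ i, ω ∉ A i) → ω ∈ B) : 1 - ∑ i, P.real (A i) ≤ P.real B := by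
  have hcover : P.real Set.univ ≤ P.real ((⋃ i, A i) ∪ B) := by
    refine ENNReal.toReal_mono (measure_ne_top _ _) (measure_mono_ae ?_)
    filter_upwards [h] with ω hω _
    by_cases hA : ω ∈ ⋃ i, A i
    · exact Or.inl hA
    · exact Or.inr (hω fun i hi => hA (Set.mem_iUnion_of_mem i hi))
  rw [probReal_univ] at hcover
  have hunion := measureReal_union_le (μ := P) (⋃ i, A i) B
  linarith [measureReal_iUnion_fintype_le (μ := P) A]

theorem theorem4p1_general {N s Q : ℕ} (hN : N = s * Q) (td : Fin Q)
    {ΩS : Type*} [MeasurableSpace ΩS] (PS : Measure ΩS) [IsFiniteMeasure PS]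
    (x : ΩS → EuclideanSpace ℂ (Fin N)) (w : ΩS → EuclideanSpace ℂ (Fin s))
    (K : Matrix (Fin N) (Fin N) ℂ) (Px : ℝ) (hPx : 0 < Px) (hK : IsLowPassCWSS s Px K)
    (hxm : Measurable x) (hx : MemLp x 2 PS) (hxx : crossCorrelation PS x x = K)
    (σw : ℝ) (hσw : 0 < σw) (hwm : Measurable w) (hw : MemLp w 2 PS)
    (hww : crossCorrelation PS w w = ((σw ^ 2 : ℝ) : ℂ) • 1)
    (hxw : crossCorrelation PS x w = 0)
    {ΩE : Type*} [MeasurableSpace ΩE] (PE : Measure ΩE) [IsProbabilityMeasure PE]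
    (E : Fin N → ΩE → ℝ) (hE : ∀ t, MemLp (E t) 2 PE) (hEind : iIndepFun E PE)
    (hE0 : ∀ t, ∀ᵐ ω ∂PE, 0 ≤ E t ω) (μE ϱE : ℝ) (hμE : 0 < μE)
    (hEmean : ∀ t, ∫ ω, E t ω ∂PE = μE) (hEvar : ∀ t, variance (E t) PE = ϱE)
    (p : Fin s → ΩE → ℝ)
    (hp : ∀ k, ∀ᵐ ω ∂PE, 0 ≤ p k ω ∧
      usedEnergy PS hN td x k (p k ω) = slotEnergy hN (fun t => E t ω) k)
    (b : ℝ) (hb : (Q : ℝ)⁻¹ ≤ b) (r : ℝ) (hr : r ∈ Set.Ioo (0 : ℝ) 1) :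
    1 - fbt s b (ϱE / μE ^ 2 * ((s : ℝ) / N)) r ≤
        PE.real {ω | mmse PS x (received hN td x w (fun k => p k ω)) <
          1 / (1 + 1 / σw ^ 2 * μE * ((N : ℝ) / s) * (1 - r)) * Px} ∧
      1 - fbn s b (ϱE / μE ^ 2 * ((s : ℝ) / N)) r ≤
        1 - fbt s b (ϱE / μE ^ 2 * ((s : ℝ) / N)) r := by
  obtain ⟨hr0, hr1⟩ := hr
  have hb0 : 0 < b := (inv_pos.2 (Nat.cast_pos.2 td.pos)).trans_le hb
  have hϱE : 0 ≤ ϱE := hEvar (epoch hN ⟨0, hK.slots_pos hN hPx.ne'⟩ td) ▸ variance_nonneg _ _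
  set V := ϱE / μE ^ 2 * ((s : ℝ) / N)
  set c := μE * ((N : ℝ) / s) * (1 - r)
  have hc0 : 0 ≤ c := mul_nonneg (by positivity) (sub_nonneg.2 hr1.le)
  have henough : ∀ᵐ ω ∂PE, (∀ k, ω ∉ {ω | slotEnergy hN (fun t => E t ω) k ≤ c}) →
      mmse PS x (received hN td x w (fun k => p k ω)) < 1 / (1 + 1 / σw ^ 2 * c) * Px := by
    filter_upwards [ae_all_iff.2 hp] with ω hω hslots
    exact mmse_received_lt hN td hK hσw.ne' hPx hxm hx hxx hwm hw hww hxw hc0 fun k =>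
      (not_le.1 (hslots k)).trans_eq (hω k).2.symm
  have hslot := fun k => measureReal_slotEnergy_le hN td.pos hEind hE hE0 hEmean hEvar hμE hb hr0 k
  have hunion : ∑ k : Fin s, PE.real {ω | slotEnergy hN (fun t => E t ω) k ≤ c} ≤ fbt s b V r := by
    calc _ ≤ ∑ _k : Fin s, bennettTail b V r := Finset.sum_le_sum fun k _ => hslot k
      _ = s * bennettTail b V r := by simp
      _ ≤ fbt s b V r := by
        rw [fbt_eq_two_mul_bennettTail]
        linarith [mul_nonneg (Nat.cast_nonneg (α := ℝ) s) (bennettTail_nonneg b V r)]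
  refine ⟨?_, sub_le_sub_left (fbt_le_fbn s hb0 (by positivity) hr0) 1⟩
  rw [show 1 / σw ^ 2 * μE * ((N : ℝ) / s) * (1 - r) = 1 / σw ^ 2 * c by ring]
  exact (sub_le_sub_left hunion 1).trans (one_sub_sum_le_measureReal henough)

namespace IsProperGaussian

variable {Ω ι κ : Type*} [MeasurableSpace Ω] [Fintype ι] [Countable κ] {P : Measure Ω}
  {X : Ω → EuclideanSpace ℂ ι} {Y : Ω → EuclideanSpace ℂ κ} {K : Matrix ι ι ℂ}

theorem memLp_two (hX : IsProperGaussian X K P) : MemLp X 2 P :=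
  hX.gaussian.memLp_two

theorem crossCorrelation_self (hX : IsProperGaussian X K P) : crossCorrelation P X X = K :=
  Matrix.ext hX.covariance

theorem crossCorrelation_eq_zero (hX : IsProperGaussian X K P) (hY : AEMeasurable Y P)
    (hXY : IndepFun X Y P) : crossCorrelation P X Y = 0 := by
  ext i j
  have hprod := hXY.integral_fun_comp_mul_comp (f := fun v : EuclideanSpace ℂ ι => v i)
    (g := fun v : EuclideanSpace ℂ κ => star (v j)) hX.measurable.aemeasurable hY
    (Continuous.aestronglyMeasurable (by fun_prop)) (Continuous.aestronglyMeasurable (by fun_prop))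
  rw [crossCorrelation, Matrix.of_apply, hprod, hX.mean_zero, zero_mul, Matrix.zero_apply]

end IsProperGaussian

theorem theorem4p1
    -- dimensions: `N` epochs, `s` degrees of freedom, `Q = N / s`, fixed initial delay `td`
    {N s Q : ℕ} (hN : N = s * Q) (td : Fin Q)
    -- signal and channel noise
    {ΩS : Type*} [MeasurableSpace ΩS] (PS : Measure ΩS) [IsProbabilityMeasure PS]
    (x : ΩS → EuclideanSpace ℂ (Fin N)) (w : ΩS → EuclideanSpace ℂ (Fin s))
    (K : Matrix (Fin N) (Fin N) ℂ) (Px : ℝ) (hPx : 0 < Px)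
    (hK : IsLowPassCWSS s Px K) (hx : IsProperGaussian x K PS)
    (σw : ℝ) (hσw : 0 < σw)
    (hw : IsProperGaussian w (((σw ^ 2 : ℝ) : ℂ) • (1 : Matrix (Fin s) (Fin s) ℂ)) PS)
    (hxw : IndepFun x w PS)
    -- i.i.d. bounded energy arrivals
    {ΩE : Type*} [MeasurableSpace ΩE] (PE : Measure ΩE) [IsProbabilityMeasure PE]
    (E : Fin N → ΩE → ℝ) (hEm : ∀ t, Measurable (E t)) (hEind : iIndepFun E PE)
    (hEid : ∀ t t', IdentDistrib (E t) (E t') PE PE)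
    (μE ϱE Emax rE : ℝ) (hμE : 0 < μE) (hEmax : Emax = rE * μE)
    (hEbd : ∀ t, ∀ᵐ ω ∂PE, 0 ≤ E t ω ∧ E t ω ≤ Emax)
    (hEmean : ∀ t, ∫ ω, E t ω ∂PE = μE) (hEvar : ∀ t, variance (E t) PE = ϱE)
    -- amplification factors: all the energy stored during a slot is used at its end
    (p : Fin s → ΩE → ℝ)
    (hp : ∀ k, ∀ᵐ ω ∂PE, 0 ≤ p k ω ∧
      usedEnergy PS hN td x k (p k ω) = slotEnergy hN (fun t => E t ω) k)
    (r : ℝ) (hr : r ∈ Set.Ioo (0 : ℝ) 1) :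
    1 - fbt s (max (rE - 1) 1) (ϱE / μE ^ 2 * ((s : ℝ) / N)) r ≤
        PE.real {ω | mmse PS x (received hN td x w (fun k => p k ω)) <
          1 / (1 + 1 / σw ^ 2 * μE * ((N : ℝ) / s) * (1 - r)) * Px} ∧
      1 - fbn s (max (rE - 1) 1) (ϱE / μE ^ 2 * ((s : ℝ) / N)) r ≤
        1 - fbt s (max (rE - 1) 1) (ϱE / μE ^ 2 * ((s : ℝ) / N)) r := by
  have hb : (Q : ℝ)⁻¹ ≤ max (rE - 1) 1 :=
    (inv_le_one_of_one_le₀ (Nat.one_le_cast.2 td.pos)).trans (le_max_right _ _)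
  exact theorem4p1_general hN td PS x w K Px hPx hK hx.measurable hx.memLp_two
    hx.crossCorrelation_self σw hσw hw.measurable hw.memLp_two hw.crossCorrelation_self
    (hx.crossCorrelation_eq_zero hw.measurable.aemeasurable hxw) PE E
    (fun t => memLp_of_bounded (hEbd t) (hEm t).aestronglyMeasurable 2) hEind
    (fun t => (hEbd t).mono fun _ h => h.1) μE ϱE hμE hEmean hEvar p hp _ hb r hr
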